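/- Let $n\ge 0$ and let $\Phi=\{e_a-e_b : a\ne b\}\subset\mathbb R^{n+1}$ be the root system of type $A_n$, with positive roots $\Phi^+=\{e_a-e_b : 1\le a<b\le n+1\}$, negative roots $\Phi^-=-\Phi^+$, simple roots $\alpha_i=e_i-e_{i+1}$ ($1\le i\le n$), and write $\alpha_{ij}=\alpha_i+\alpha_{i+1}+\cdots+\alpha_j$ for $1\le i\le j\le n$, so that $\Phi^+=\{\alpha_{ij}\}$. Let $W\cong S_{n+1}$ be the Weyl group, generated by the orthogonal reflections $s_\alpha$, $\alpha\in\Phi$, and for $w\in W$ let $N(w)=\Phi^+\cap w(\Phi^-)$. The Shi arrangement consists of the hyperplanes $H_{\alpha,k}=\{x:\langle\alpha,x\rangle=k\}$ with $\alpha\in\Phi^+$, $k\in\{0,1\}$; its regions are the connected components of the complement of the union of these hyperplanes. The Weyl cone of $w\in W$ is $C_w=w(C_e)$, where $C_e=\{x:\langle\alpha,x\rangle>0\text{ for all }\alpha\in\Phi^+\}$. For $p,q\in\mathbb Z^2$ let $\gamma(p\to q)$ be the number of lattice paths from $p$ to $q$ with unit steps to the east and to the north, all of whose vertices lie weakly above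 the diagonal $x=y$ (that is, satisfy $x\le y$). Theorem. Let $w\in W$ and let $N(w^{-1})=\{\alpha_{i_1j_1},\ldots,\alpha_{i_kj_k}\}$, listed without repetition. Put $I=(0,1)$, $F=(n,n+1)$, $v^{tr}_\ell=(i_\ell,j_\ell+1)$ and $v^{bl}_\ell=(i_\ell-1,j_\ell)$. Then the number of regions of the Shi arrangement contained in $C_w$ is finite and equal to $$\det\begin{pmatrix} 1 & \gamma(v^{tr}_2\to v^{bl}_1) & \cdots & \gamma(v^{tr}_k\to v^{bl}_1) & \gamma(I\to v^{bl}_1)\\ \gamma(v^{tr}_1\to v^{bl}_2) & 1 & \cdots & \gamma(v^{tr}_k\to v^{bl}_2) & \gamma(I\to v^{bl}_2)\\ \vdots & \vdots & \ddots & \vdots & \vdots\\ \gamma(v^{tr}_1\to v^{bl}_k) & \gamma(v^{tr}_2\to v^{bl}_k) & \cdots & 1 & \gamma(I\to v^{bl}_k)\\ \gamma(v^{tr}_1\to F) & \gamma(v^{tr}_2\to F) & \cdots & \gamma(v^{tr}_k\to F) & \gamma(I\to F) \end{pmatrix}.$$ Moreover, for all integers $x_1\le y_1$ and $x_2\le y_2$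 the number of paths $\gamma((x_1,y_1)\to(x_2,y_2))$ is finite and $$\gamma((x_1,y_1)\to(x_2,y_2))=\begin{cases}\dbinom{x_2+y_2-x_1-y_1}{x_2-x_1}-\dbinom{x_2+y_2-x_1-y_1}{y_2-x_1+1} & \text{if } x_1\le x_2 \text{ and } y_1\le y_2,\\ 0 & \text{otherwise,}\end{cases}$$ where $\binom{N}{m}=0$ for $m>N$. -/

import Mathlib

namespace ShiTypeA

/-! ### Root systems and Shi arrangements

`P` is the set of positive roots of a root system in a Euclidean space `E`. -/

section Arrangement

variable {E : Type*} [NormedAddCommGroup E] [InnerProductSpace ℝ E]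

/-- The hyperplane `H_{α,k} = {x | ⟨α, x⟩ = k}`. -/
def hyperplane (α : E) (k : ℝ) : Set E := {x | inner ℝ α x = k}

/-- The negative roots `Φ⁻ = -Φ⁺`. -/
def negRoots (P : Set E) : Set E := {α | -α ∈ P}

/-- All roots, `Φ = Φ⁺ ∪ Φ⁻`. -/
def roots (P : Set E) : Set E := P ∪ negRoots P

/-- The orthogonal reflection `s_α`, fixing `H_{α,0}` pointwise and sending `α` to `-α`. -/
noncomputable def rootReflection (α : E) : E ≃ₗᵢ[ℝ] E :=
  (Submodule.span ℝ {α})ᗮ.reflection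

/-- The Weyl group: the group generated by the reflections `s_α`, for `α` a root. -/
def weylGroup (P : Set E) : Subgroup (E ≃ₗᵢ[ℝ] E) :=
  Subgroup.closure (rootReflection '' roots P)

/-- The (left) inversion set `N(w) = Φ⁺ ∩ w(Φ⁻)`. -/
def inversionSet (P : Set E) (w : E ≃ₗᵢ[ℝ] E) : Set E := P ∩ w '' negRoots P

/-- The Shi arrangement `{H_{α,k} | α ∈ Φ⁺, k ∈ {0, 1}}`. -/
def shiArrangement (P : Set E) : Set (Set E) :=
  {H | ∃ α ∈ P, H = hyperplane α 0 ∨ H = hyperplane α 1}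

/-- The regions of an arrangement: the connected components of the complement of the
union of its hyperplanes. -/
def regions (A : Set (Set E)) : Set (Set E) :=
  {R | ∃ x ∈ (⋃₀ A)ᶜ, R = connectedComponentIn (⋃₀ A)ᶜ x}

/-- The dominant cone `C_e`: the intersection of the open positive half-spaces of the
hyperplanes `H_{α,0}`, `α ∈ Φ⁺`. -/
def dominantCone (P : Set E) : Set E := {x | ∀ α ∈ P, 0 < inner ℝ α x}

/-- The Weyl cone `C_w = w(C_e)`. -/
def weylCone (P : Set E) (w : E ≃ₗᵢ[ℝ] E) : Set E := w '' dominantCone P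

/-- The Shi regions contained in the Weyl cone `C_w`. -/
def regionsInCone (P : Set E) (w : E ≃ₗᵢ[ℝ] E) : Set (Set E) :=
  {R | R ∈ regions (shiArrangement P) ∧ R ⊆ weylCone P w}

end Arrangement

/-! ### The root system of type `A_n` in `ℝ^(n+1)` -/

/-- The positive roots `e_a - e_b`, `a < b`, of type `A_n`. -/
def posRootsA (n : ℕ) : Set (EuclideanSpace ℝ (Fin (n + 1))) :=
  {α | ∃ a b : Fin (n + 1), a < b ∧
    α = EuclideanSpace.single a (1 : ℝ) - EuclideanSpace.single b (1 : ℝ)}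

/-- The simple roots. As `Fin n` starts at `0`, `simpleRootA n k` is the root usually called
`α_{k+1} = e_{k+1} - e_{k+2}`. -/
noncomputable def simpleRootA (n : ℕ) (k : Fin n) : EuclideanSpace ℝ (Fin (n + 1)) :=
  EuclideanSpace.single k.castSucc (1 : ℝ) - EuclideanSpace.single k.succ (1 : ℝ)

/-- The sum of the consecutive simple roots with indices from `i` to `j` (indices starting
at `0`). In the usual indexing this is `α_{i+1,j+1}`. -/
noncomputable def rootA (n : ℕ) (i j : Fin n) : EuclideanSpace ℝ (Fin (n + 1)) :=
  ∑ k ∈ Finset.Icc i j, simpleRootA n k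

/-! ### Lattice paths -/

/-- A unit step to the east or to the north in `ℤ²`. -/
def LatticeStep (p q : ℤ × ℤ) : Prop := q = (p.1 + 1, p.2) ∨ q = (p.1, p.2 + 1)

/-- The lattice paths from `p` to `q` with east and north steps all of whose vertices are
weakly above the diagonal `x = y`; a path is given by the list of its vertices. -/
def pathsAbove (p q : ℤ × ℤ) : Set (List (ℤ × ℤ)) :=
  {l | l.IsChain LatticeStep ∧ l.head? = some p ∧ l.getLast? = some q ∧ ∀ v ∈ l, v.1 ≤ v.2}

/-- `γ(p → q | weakly above x = y)`, the number of such paths. -/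
noncomputable def gammaAbove (p q : ℤ × ℤ) : ℤ := ((pathsAbove p q).ncard : ℤ)

/-- The source `I = (0, 1)`. -/
def ptI : ℤ × ℤ := (0, 1)

/-- The sink `F = (n, n + 1)`. -/
def ptF (n : ℕ) : ℤ × ℤ := ((n : ℤ), (n : ℤ) + 1)

/-- The top right corner of the box of `rootA n i j`: this is `(i', j' + 1)` for the usual
indices `i' = i + 1` and `j' = j + 1`. -/
def vTR {n : ℕ} (i j : Fin n) : ℤ × ℤ := ((i : ℤ) + 1, ((j : ℤ) + 1) + 1)

/-- The bottom left corner of the box of `rootA n i j`: this is `(i' - 1, j')` for the usual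
indices `i' = i + 1` and `j' = j + 1`. -/
def vBL {n : ℕ} (i j : Fin n) : ℤ × ℤ := (((i : ℤ) + 1) - 1, (j : ℤ) + 1)

/-- The `(k+1) × (k+1)` matrix of path counts attached to a list
`rootA n (i 0) (j 0), …, rootA n (i (k-1)) (j (k-1))` of roots; the `Unit` index is the last
row and the last column. -/
noncomputable def cornerMatrix (n : ℕ) {k : ℕ} (i j : Fin k → Fin n) :
    Matrix (Fin k ⊕ Unit) (Fin k ⊕ Unit) ℤ :=
  Matrix.fromBlocks
    (Matrix.of fun a b : Fin k =>
      if a = b then 1 else gammaAbove (vTR (i b) (j b)) (vBL (i a) (j a)))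
    (Matrix.of fun (a : Fin k) (_ : Unit) => gammaAbove ptI (vBL (i a) (j a)))
    (Matrix.of fun (_ : Unit) (b : Fin k) => gammaAbove (vTR (i b) (j b)) (ptF n))
    (Matrix.of fun (_ _ : Unit) => gammaAbove ptI (ptF n))

end ShiTypeA

namespace ShiTypeA

/-! Pull everything back by `w`. For `y` in the dominant cone, the side of `w y` with respect to a
Shi hyperplane can only vary on the hyperplanes with `⟨β, y⟩ = 1`, where `β` is a positive root
outside `N(w⁻¹)`: a root in `N(w⁻¹)` becomes negative under `w`, and the corresponding positive root
is negative on `C_w`. A region of `C_w` is therefore the set of those `β` with `⟨β, y⟩ > 1`. These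
sets are exactly the upper sets of the root poset with `N(w⁻¹)` removed
(`cellPattern_mem_cellFilters`, `exists_cellPattern_eq`). An upper set is determined by its
antichain of minimal elements, so regions correspond to antichains avoiding `N(w⁻¹)`
(`card_cellFilters`).

Writing a root as a cell `(i, j)`, an antichain is a set of cells strictly increasing in both
coordinates, that is, the set of valleys (east step followed by north step) of a lattice path above
the diagonal. Let `V(x, t)` be the number of such sets in the box `i < x`, `j < t` that avoid `N`.
Splitting a path from `I` at its first valley in `N` gives `γ(I → (x, t + 1)) = V(x, t) + ∑ p ∈ N,
V(p) γ(v^tr_p → (x, t + 1))`, which is `gammaAbove_ptI_eq_sum`; it is proved by letting both sides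
satisfy the same last-step recursion. Evaluated at the points `v^bl` and `F`, this is a linear
system for the numbers `V(p)` and `V(n, n)`. Its coefficient matrix is unitriangular up to
reordering, so the determinant of the theorem is `V(n, n)` by Cramer's rule (`det_cornerMatrix`). -/

/-! ### Lattice paths above the diagonal and the ballot formula -/

lemma pathsAbove_mono {p q : ℤ × ℤ} {l : List (ℤ × ℤ)} (h : l ∈ pathsAbove p q) :
    p.1 ≤ q.1 ∧ p.2 ≤ q.2 := by
  obtain ⟨hc, hh, hl, -⟩ := h
  induction l generalizing p with
  | nil => simp at hh
  | cons a l ih =>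
    simp only [List.head?_cons, Option.some.injEq] at hh
    subst hh
    cases l with
    | nil =>
      simp only [List.getLast?_singleton, Option.some.injEq] at hl
      subst hl
      exact ⟨le_rfl, le_rfl⟩
    | cons b l =>
      rw [List.isChain_cons_cons] at hc
      have := ih (p := b) hc.2 rfl (by simpa using hl)
      rcases hc.1 with h | h <;> subst h <;> simp only at this <;> constructor <;> omega

lemma pathsAbove_eq_empty {p q : ℤ × ℤ} (h : ¬ (p.1 ≤ q.1 ∧ p.2 ≤ q.2)) :
    pathsAbove p q = ∅ :=
  Set.eq_empty_of_forall_notMem fun _ hl => h (pathsAbove_mono hl)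

lemma pathsAbove_eq_empty_of_below {p q : ℤ × ℤ} (h : q.2 < q.1) : pathsAbove p q = ∅ := by
  refine Set.eq_empty_of_forall_notMem fun l ⟨_, _, hl, ha⟩ => ?_
  have := ha q (List.mem_of_getLast? hl)
  omega

lemma mem_pathsAbove_concat {p q r : ℤ × ℤ} {l : List (ℤ × ℤ)} (hl : l ≠ []) :
    l ++ [r] ∈ pathsAbove p q ↔
      r = q ∧ q.1 ≤ q.2 ∧ (l ∈ pathsAbove p (q.1 - 1, q.2) ∨ l ∈ pathsAbove p (q.1, q.2 - 1)) := by
  obtain ⟨l', s, rfl⟩ : ∃ l' s, l = l' ++ [s] := by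
    rcases List.eq_nil_or_concat l with h | ⟨l', s, h⟩
    · exact absurd h hl
    · exact ⟨l', s, by simpa using h⟩
  have hstep : LatticeStep s r ↔ s = (r.1 - 1, r.2) ∨ s = (r.1, r.2 - 1) := by
    obtain ⟨r1, r2⟩ := r
    obtain ⟨s1, s2⟩ := s
    simp only [LatticeStep, Prod.mk.injEq]
    constructor <;> rintro (h | h) <;> [left; right; left; right] <;> omega
  have hhead : ((l' ++ [s]) ++ [r]).head? = (l' ++ [s]).head? := by
    cases l' <;> simp
  have hchain : ((l' ++ [s]) ++ [r]).IsChain LatticeStep ↔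
      (l' ++ [s]).IsChain LatticeStep ∧ LatticeStep s r := by
    rw [List.isChain_append]
    simp
  simp only [pathsAbove, Set.mem_ofPred_eq, hhead, hchain, hstep]
  simp only [List.getLast?_append, List.getLast?_singleton, Option.some_or, Option.some.injEq,
    List.mem_append, List.mem_singleton]
  constructor
  · rintro ⟨⟨h1, h2⟩, h3, rfl, h4⟩
    refine ⟨rfl, h4 r (Or.inr rfl), ?_⟩
    rcases h2 with h2 | h2
    · exact Or.inl ⟨h1, h3, h2, fun v hv => h4 v (Or.inl hv)⟩
    · exact Or.inr ⟨h1, h3, h2, fun v hv => h4 v (Or.inl hv)⟩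
  · rintro ⟨rfl, h0, h | h⟩
    · refine ⟨⟨h.1, Or.inl h.2.2.1⟩, h.2.1, rfl, ?_⟩
      rintro v (hv | rfl)
      · exact h.2.2.2 v hv
      · exact h0
    · refine ⟨⟨h.1, Or.inr h.2.2.1⟩, h.2.1, rfl, ?_⟩
      rintro v (hv | rfl)
      · exact h.2.2.2 v hv
      · exact h0

lemma pathsAbove_eq_union {p q : ℤ × ℤ} (hq : q.1 ≤ q.2) :
    pathsAbove p q = (if p = q then {[p]} else ∅) ∪
      ((fun l => l ++ [q]) '' pathsAbove p (q.1 - 1, q.2) ∪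
        (fun l => l ++ [q]) '' pathsAbove p (q.1, q.2 - 1)) := by
  ext l
  rcases List.eq_nil_or_concat l with rfl | ⟨l', s, rfl⟩
  · by_cases h : p = q <;> simp [pathsAbove, h]
  rw [List.concat_eq_append]
  have hne : ∀ {r : ℤ × ℤ} {m}, m ∈ pathsAbove p r → m ≠ [] := by
    rintro r m ⟨_, h, _⟩ rfl
    simp at h
  by_cases hl : l' = []
  · subst hl
    have h1 : ∀ r : ℤ × ℤ, ([] : List (ℤ × ℤ)) ∉ pathsAbove p r := fun r h => hne h rfl
    have h2 : [s] ∈ pathsAbove p q ↔ p = q ∧ s = p := by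
      constructor
      · rintro ⟨-, hh, hl, -⟩
        simp only [List.head?_cons, List.getLast?_singleton, Option.some.injEq] at hh hl
        exact ⟨hh.symm.trans hl, hh⟩
      · rintro ⟨rfl, rfl⟩
        exact ⟨List.isChain_singleton _, rfl, rfl, by simpa using hq⟩
    have h3 : ∀ r, [s] ∉ (fun l => l ++ [q]) '' pathsAbove p r := by
      rintro r ⟨m, hm, he⟩
      exact hne hm (by simpa using congrArg List.length he)
    rw [List.nil_append, h2]
    simp only [Set.mem_union, h3, or_false]
    split_ifs with h <;> simp [h]
  · rw [mem_pathsAbove_concat hl]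
    have : l' ++ [s] ∉ (if p = q then {[p]} else ∅ : Set (List (ℤ × ℤ))) := by
      split_ifs <;> simp only [Set.mem_empty_iff_false, not_false_eq_true,
        Set.mem_singleton_iff, List.append_eq_singleton_iff]
      simp [hl]
    simp only [Set.mem_union, this, false_or, Set.mem_image]
    constructor
    · rintro ⟨rfl, _, h | h⟩
      · exact Or.inl ⟨l', h, rfl⟩
      · exact Or.inr ⟨l', h, rfl⟩
    · rintro (⟨m, h, he⟩ | ⟨m, h, he⟩) <;> obtain ⟨rfl, hs⟩ := List.append_inj' he rfl <;>
        obtain rfl := List.singleton_inj.1 hs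
      · exact ⟨rfl, hq, Or.inl h⟩
      · exact ⟨rfl, hq, Or.inr h⟩

lemma pathsAbove_finite (p q : ℤ × ℤ) : (pathsAbove p q).Finite := by
  have key : ∀ (m : ℕ) (q : ℤ × ℤ), q.1 + q.2 < p.1 + p.2 + m → (pathsAbove p q).Finite := by
    intro m
    induction m with
    | zero =>
      intro q hq
      rw [pathsAbove_eq_empty (by push_cast at hq; omega)]
      exact Set.finite_empty
    | succ m ih =>
      intro q hq
      by_cases h : q.1 ≤ q.2
      · rw [pathsAbove_eq_union h]
        refine Set.Finite.union (by split_ifs <;> simp) (Set.Finite.union ?_ ?_)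
        · exact (ih _ (by push_cast at hq ⊢; omega)).image _
        · exact (ih _ (by push_cast at hq ⊢; omega)).image _
      · rw [pathsAbove_eq_empty_of_below (by omega)]
        exact Set.finite_empty
  exact key (q.1 + q.2 - p.1 - p.2 + 1).toNat q (by omega)

lemma gammaAbove_eq_zero {p q : ℤ × ℤ} (h : ¬ (p.1 ≤ q.1 ∧ p.2 ≤ q.2)) : gammaAbove p q = 0 := by
  simp [gammaAbove, pathsAbove_eq_empty h]

lemma gammaAbove_eq_zero_of_below {p q : ℤ × ℤ} (h : q.2 < q.1) : gammaAbove p q = 0 := by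
  simp [gammaAbove, pathsAbove_eq_empty_of_below h]

/-- The recursion for path counts, according to the last step. -/
lemma gammaAbove_rec {p q : ℤ × ℤ} (hq : q.1 ≤ q.2) :
    gammaAbove p q = (if p = q then 1 else 0) +
      (gammaAbove p (q.1 - 1, q.2) + gammaAbove p (q.1, q.2 - 1)) := by
  have hinj : Function.Injective (fun l : List (ℤ × ℤ) => l ++ [q]) :=
    List.append_left_injective [q]
  unfold gammaAbove
  have hf := fun r => (pathsAbove_finite p r).image (fun l => l ++ [q])
  have hd₁ : Disjoint ((fun l => l ++ [q]) '' pathsAbove p (q.1 - 1, q.2))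
      ((fun l => l ++ [q]) '' pathsAbove p (q.1, q.2 - 1)) := by
    rw [Set.disjoint_image_iff hinj, Set.disjoint_left]
    rintro l ⟨_, _, h1, _⟩ ⟨_, _, h2, _⟩
    rw [h1] at h2
    simp at h2
  have hd₂ : Disjoint (if p = q then {[p]} else ∅ : Set (List (ℤ × ℤ)))
      ((fun l => l ++ [q]) '' pathsAbove p (q.1 - 1, q.2) ∪
        (fun l => l ++ [q]) '' pathsAbove p (q.1, q.2 - 1)) := by
    split_ifs
    · rw [Set.disjoint_singleton_left]
      rintro (⟨m, ⟨-, hm, -⟩, h⟩ | ⟨m, ⟨-, hm, -⟩, h⟩) <;>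
        obtain rfl : m = [] := by simpa using congrArg List.length h
      all_goals simp at hm
    · simp
  rw [pathsAbove_eq_union hq, Set.ncard_union_eq hd₂ (by split_ifs <;> simp) ((hf _).union (hf _)),
    Set.ncard_union_eq hd₁ (hf _) (hf _),
    Set.ncard_image_of_injective _ hinj, Set.ncard_image_of_injective _ hinj]
  split_ifs <;> simp

/-- Both sides obey Pascal's recursion by the last step. The bound allows endpoints one unit below
the diagonal (`a = b + c + 1`), where no path ends and the two binomials coincide; this is the
boundary value that the recursion needs. -/
lemma gammaAbove_formula (x : ℤ) (c a b : ℕ) (h : a ≤ b + c + 1) :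
    gammaAbove (x, x + c) (x + a, x + c + b) =
      ((a + b).choose a : ℤ) - ((a + b).choose (b + c + 1) : ℤ) := by
  induction hm : a + b generalizing a b with
  | zero =>
    obtain rfl : a = 0 := by omega
    obtain rfl : b = 0 := by omega
    rw [gammaAbove_rec (by simp), gammaAbove_eq_zero (by simp), gammaAbove_eq_zero (by simp)]
    simp
  | succ m ih =>
    rcases h.eq_or_lt with h | h
    · rw [gammaAbove_eq_zero_of_below (by simp only; omega), ← hm, h]
      simp
    rw [gammaAbove_rec (by simp only; omega), if_neg (by simp only [Prod.mk.injEq]; omega)]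
    simp only
    rcases a with _ | a
    · rw [gammaAbove_eq_zero (by simp)]
      obtain ⟨b, rfl⟩ : ∃ b', b = b' + 1 := ⟨b - 1, by omega⟩
      have := ih 0 b (by omega) (by omega)
      rw [show x + (c : ℤ) + ((b + 1 : ℕ) : ℤ) - 1 = x + c + (b : ℕ) by push_cast; ring, this]
      rw [Nat.choose_eq_zero_of_lt (show m + 1 < b + 1 + c + 1 by omega),
        Nat.choose_eq_zero_of_lt (show m < b + c + 1 by omega)]
      simp
    · rw [show x + ((a + 1 : ℕ) : ℤ) - 1 = x + (a : ℕ) by push_cast; ring,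
        ih a b (by omega) (by omega)]
      rcases b with _ | b
      · rw [gammaAbove_eq_zero (by simp)]
        obtain rfl : m = a := by omega
        rw [Nat.choose_eq_zero_of_lt (show m < 0 + c + 1 by omega),
          Nat.choose_eq_zero_of_lt (show m + 1 < 0 + c + 1 by omega)]
        simp
      · rw [show x + (c : ℤ) + ((b + 1 : ℕ) : ℤ) - 1 = x + c + (b : ℕ) by push_cast; ring,
          ih (a + 1) b (by omega) (by omega), Nat.choose_succ_succ m a,
          show b + 1 + c + 1 = (b + c + 1) + 1 by ring, Nat.choose_succ_succ m (b + c + 1)]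
        push_cast
        ring

theorem gammaAbove_eq (x₁ y₁ x₂ y₂ : ℤ) (h₁ : x₁ ≤ y₁) (h₂ : x₂ ≤ y₂) :
    gammaAbove (x₁, y₁) (x₂, y₂) =
      if x₁ ≤ x₂ ∧ y₁ ≤ y₂ then
        ((x₂ + y₂ - x₁ - y₁).toNat.choose (x₂ - x₁).toNat : ℤ) -
          ((x₂ + y₂ - x₁ - y₁).toNat.choose (y₂ - x₁ + 1).toNat : ℤ)
      else 0 := by
  split_ifs with h
  · obtain ⟨c, rfl⟩ := Int.le.dest h₁
    obtain ⟨a, rfl⟩ := Int.le.dest h.1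
    obtain ⟨b, rfl⟩ := Int.le.dest h.2
    rw [gammaAbove_formula x₁ c a b (by omega)]
    congr 3 <;> omega
  · exact gammaAbove_eq_zero h

/-! ### Valley sets and the decomposition at the first forbidden valley -/

/-- The finite sets of cells `(i, j)`, `i ≤ j`, in the box `i < x`, `j < t` and outside `N`
that increase strictly in both coordinates: the possible sets of valleys of a path. -/
def valleySets (N : Finset (ℕ × ℕ)) (x t : ℕ) : Finset (Finset (ℕ × ℕ)) :=
  {S ∈ (Finset.range x ×ˢ Finset.range t).powerset |
    (∀ p ∈ S, p.1 ≤ p.2 ∧ p ∉ N) ∧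
      ∀ p ∈ S, ∀ q ∈ S, p ≠ q → (p.1 < q.1 ∧ p.2 < q.2) ∨ (q.1 < p.1 ∧ q.2 < p.2)}

lemma mem_valleySets {N : Finset (ℕ × ℕ)} {x t : ℕ} {S : Finset (ℕ × ℕ)} :
    S ∈ valleySets N x t ↔
      (∀ p ∈ S, (p.1 < x ∧ p.2 < t) ∧ p.1 ≤ p.2 ∧ p ∉ N) ∧
        ∀ p ∈ S, ∀ q ∈ S, p ≠ q → (p.1 < q.1 ∧ p.2 < q.2) ∨ (q.1 < p.1 ∧ q.2 < p.2) := by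
  simp only [valleySets, Finset.mem_filter, Finset.mem_powerset, Finset.subset_iff,
    Finset.mem_product, Finset.mem_range]
  constructor
  · rintro ⟨h1, h2, h3⟩
    exact ⟨fun p hp => ⟨h1 hp, h2 p hp⟩, h3⟩
  · rintro ⟨h1, h2⟩
    exact ⟨fun p hp => (h1 p hp).1, fun p hp => (h1 p hp).2, h2⟩

/-- Only the cells of the box with `i ≤ j` matter, so boxes that differ below the diagonal give the
same sets. -/
lemma valleySets_eq_of_forall {N : Finset (ℕ × ℕ)} {x t x' t' : ℕ}
    (h : ∀ i j : ℕ, i ≤ j → ((i < x ∧ j < t) ↔ (i < x' ∧ j < t'))) :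
    valleySets N x t = valleySets N x' t' := by
  ext S
  rw [mem_valleySets, mem_valleySets]
  refine and_congr_left fun _ => forall₂_congr fun p _ => and_congr_left fun hp => h _ _ hp.1

lemma card_valleySets_of_min_eq_zero (N : Finset (ℕ × ℕ)) {x t : ℕ} (h : x = 0 ∨ t = 0) :
    (valleySets N x t).card = 1 := by
  rw [Finset.card_eq_one]
  refine ⟨∅, ?_⟩
  ext S
  rw [mem_valleySets, Finset.mem_singleton]
  constructor
  · rintro ⟨h1, -⟩
    refine Finset.eq_empty_of_forall_notMem fun p hp => ?_
    have := (h1 p hp).1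
    omega
  · rintro rfl
    simp

lemma valleySets_mono (N : Finset (ℕ × ℕ)) {x t x' t' : ℕ} (hx : x ≤ x') (ht : t ≤ t') :
    valleySets N x t ⊆ valleySets N x' t' := by
  intro S
  rw [mem_valleySets, mem_valleySets]
  exact fun h => ⟨fun p hp => ⟨⟨(h.1 p hp).1.1.trans_le hx, (h.1 p hp).1.2.trans_le ht⟩,
    (h.1 p hp).2⟩, h.2⟩

lemma valleySets_inter (N : Finset (ℕ × ℕ)) (x t : ℕ) :
    valleySets N x (t + 1) ∩ valleySets N (x + 1) t = valleySets N x t := by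
  ext S
  simp only [Finset.mem_inter, mem_valleySets]
  constructor
  · rintro ⟨⟨h1, h2⟩, h3, -⟩
    exact ⟨fun p hp => ⟨⟨(h1 p hp).1.1, (h3 p hp).1.2⟩, (h1 p hp).2⟩, h2⟩
  · rintro ⟨h1, h2⟩
    exact ⟨⟨fun p hp => ⟨⟨(h1 p hp).1.1, (h1 p hp).1.2.trans (by omega)⟩, (h1 p hp).2⟩, h2⟩,
      fun p hp => ⟨⟨(h1 p hp).1.1.trans (by omega), (h1 p hp).1.2⟩, (h1 p hp).2⟩, h2⟩

/-- Failing to fit in either smaller box forces a cell with `i = x` and a cell with `j = t`. Two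
distinct cells increase in both coordinates, so these are one cell, the corner `(x, t)`. -/
lemma mem_valleySets_succ_succ_of_mem {N : Finset (ℕ × ℕ)} {x t : ℕ} {S : Finset (ℕ × ℕ)}
    (hS : S ∈ valleySets N (x + 1) (t + 1)) (h : S ∉ valleySets N x (t + 1))
    (h' : S ∉ valleySets N (x + 1) t) :
    (x, t) ∈ S ∧ S.erase (x, t) ∈ valleySets N x t := by
  rw [mem_valleySets] at hS h h'
  obtain ⟨h1, h2⟩ := hS
  have ha : ∃ p ∈ S, p.1 = x := by
    by_contra! hc
    refine h ⟨fun p hp => ⟨⟨?_, (h1 p hp).1.2⟩, (h1 p hp).2⟩, h2⟩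
    have := hc p hp
    have := h1 p hp
    omega
  have hb : ∃ p ∈ S, p.2 = t := by
    by_contra! hc
    refine h' ⟨fun p hp => ⟨⟨(h1 p hp).1.1, ?_⟩, (h1 p hp).2⟩, h2⟩
    have := hc p hp
    have := h1 p hp
    omega
  obtain ⟨p, hp, hpx⟩ := ha
  obtain ⟨q, hq, hqt⟩ := hb
  have hpq : p = q := by
    by_contra hne
    have := h2 p hp q hq hne
    have := h1 p hp
    have := h1 q hq
    omega
  subst hpq
  obtain rfl : p = (x, t) := Prod.ext hpx hqt
  refine ⟨hp, mem_valleySets.2 ⟨fun r hr => ?_, fun r hr s hs => ?_⟩⟩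
  · rw [Finset.mem_erase] at hr
    have h3 := h2 r hr.2 _ hp hr.1
    have h4 := h1 r hr.2
    simp only at h3
    exact ⟨by omega, h4.2⟩
  · exact h2 r (Finset.mem_of_mem_erase hr) s (Finset.mem_of_mem_erase hs)

lemma insert_mem_valleySets {N : Finset (ℕ × ℕ)} {x t : ℕ} (hxt : x ≤ t) (hN : (x, t) ∉ N)
    {S : Finset (ℕ × ℕ)} (hS : S ∈ valleySets N x t) :
    insert (x, t) S ∈ valleySets N (x + 1) (t + 1) := by
  rw [mem_valleySets] at hS ⊢
  obtain ⟨h1, h2⟩ := hS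
  refine ⟨fun p hp => ?_, fun p hp q hq hne => ?_⟩
  · rcases Finset.mem_insert.1 hp with rfl | hp
    · exact ⟨by simp, hxt, hN⟩
    · exact ⟨⟨(h1 p hp).1.1.trans (by omega), (h1 p hp).1.2.trans (by omega)⟩, (h1 p hp).2⟩
  · rcases Finset.mem_insert.1 hp with rfl | hp <;> rcases Finset.mem_insert.1 hq with rfl | hq
    · exact absurd rfl hne
    · exact Or.inr (h1 q hq).1
    · exact Or.inl (h1 p hp).1
    · exact h2 p hp q hq hne

lemma valleySets_succ_succ (N : Finset (ℕ × ℕ)) {x t : ℕ} (hxt : x ≤ t) :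
    valleySets N (x + 1) (t + 1) = (valleySets N x (t + 1) ∪ valleySets N (x + 1) t) ∪
      (if (x, t) ∈ N then ∅ else (valleySets N x t).image (insert (x, t))) := by
  apply Finset.Subset.antisymm
  · intro S hS
    by_cases h : S ∈ valleySets N x (t + 1)
    · simp [h]
    by_cases h' : S ∈ valleySets N (x + 1) t
    · simp [h']
    obtain ⟨h1, h2⟩ := mem_valleySets_succ_succ_of_mem hS h h'
    rw [if_neg ((mem_valleySets.1 hS).1 _ h1).2.2]
    exact Finset.mem_union_right _ (Finset.mem_image.2 ⟨_, h2, Finset.insert_erase h1⟩)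
  · refine Finset.union_subset (Finset.union_subset (valleySets_mono N (by omega) le_rfl)
      (valleySets_mono N le_rfl (by omega))) ?_
    split_ifs with hN
    · exact Finset.empty_subset _
    · intro S hS
      obtain ⟨S, hT, rfl⟩ := Finset.mem_image.1 hS
      exact insert_mem_valleySets hxt hN hT

/-- Inclusion–exclusion over the two smaller boxes subtracts `V(x, t)`; the sets containing the
corner `(x, t)` restore exactly this amount, unless the corner is forbidden. -/
lemma card_valleySets_succ_succ (N : Finset (ℕ × ℕ)) {x t : ℕ} (hxt : x ≤ t) :
    ((valleySets N (x + 1) (t + 1)).card : ℤ) =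
      (valleySets N x (t + 1)).card + (valleySets N (x + 1) t).card -
        if (x, t) ∈ N then ((valleySets N x t).card : ℤ) else 0 := by
  have hnot : ∀ S ∈ valleySets N x t, (x, t) ∉ S := fun S hS h =>
    lt_irrefl _ ((mem_valleySets.1 hS).1 _ h).1.1
  have hdisj : Disjoint (valleySets N x (t + 1) ∪ valleySets N (x + 1) t)
      (if (x, t) ∈ N then ∅ else (valleySets N x t).image (insert (x, t))) := by
    split_ifs
    · simp
    · rw [Finset.disjoint_right]
      intro S hS hS'
      obtain ⟨S, _, rfl⟩ := Finset.mem_image.1 hS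
      rcases Finset.mem_union.1 hS' with h | h
      · exact lt_irrefl _ ((mem_valleySets.1 h).1 _ (Finset.mem_insert_self _ _)).1.1
      · exact lt_irrefl _ ((mem_valleySets.1 h).1 _ (Finset.mem_insert_self _ _)).1.2
  have hcard := Finset.card_union_add_card_inter (valleySets N x (t + 1)) (valleySets N (x + 1) t)
  rw [valleySets_inter] at hcard
  rw [valleySets_succ_succ N hxt, Finset.card_union_of_disjoint hdisj]
  split_ifs
  · rw [Finset.card_empty]
    omega
  · rw [Finset.card_image_of_injOn]
    · omega
    · intro S hS T hT h
      rw [← Finset.erase_insert (hnot S hS), ← Finset.erase_insert (hnot T hT)]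
      exact congrArg (fun U => Finset.erase U (x, t)) h

/-- Sort the paths from `I` by their first valley in `N`. -/
theorem gammaAbove_ptI_eq_sum (N : Finset (ℕ × ℕ)) (hN : ∀ p ∈ N, p.1 ≤ p.2) (x t : ℕ)
    (h : x ≤ t + 1) :
    gammaAbove ptI (x, t + 1) = (valleySets N x t).card +
      ∑ p ∈ N, (valleySets N p.1 p.2).card * gammaAbove (p.1 + 1, p.2 + 2) (x, t + 1) := by
  induction hm : x + t generalizing x t with
  | zero =>
    obtain rfl : x = 0 := by omega
    obtain rfl : t = 0 := by omega
    rw [card_valleySets_of_min_eq_zero N (Or.inl rfl), Finset.sum_eq_zero, gammaAbove_rec (by simp),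
      gammaAbove_eq_zero (by simp [ptI]), gammaAbove_eq_zero (by simp [ptI])]
    · simp [ptI]
    · intro p _
      rw [gammaAbove_eq_zero (by simp only; omega), mul_zero]
  | succ m ih =>
    rw [gammaAbove_rec (p := ptI) (by simp only; omega),
      if_neg (by simp only [ptI, Prod.mk.injEq]; omega), zero_add]
    rcases x with _ | x
    · obtain ⟨t, rfl⟩ : ∃ t', t = t' + 1 := ⟨t - 1, by omega⟩
      rw [gammaAbove_eq_zero (by simp [ptI]), card_valleySets_of_min_eq_zero N (Or.inl rfl),
        Finset.sum_eq_zero]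
      · have := ih 0 t (by omega) (by omega)
        rw [card_valleySets_of_min_eq_zero N (Or.inl rfl), Finset.sum_eq_zero] at this
        · simpa using this
        · intro p _
          rw [gammaAbove_eq_zero (by simp only; omega), mul_zero]
      · intro p _
        rw [gammaAbove_eq_zero (by simp only; omega), mul_zero]
    · have hx : (((x + 1 : ℕ) : ℤ) - 1) = x := by push_cast; ring
      simp only [hx]
      rw [ih x t (by omega) (by omega)]
      rcases t with _ | t
      · obtain rfl : x = 0 := by omega
        rw [gammaAbove_eq_zero (by simp [ptI]), card_valleySets_of_min_eq_zero N (Or.inl rfl),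
          card_valleySets_of_min_eq_zero N (Or.inr rfl), Finset.sum_eq_zero, Finset.sum_eq_zero]
        · simp
        all_goals
          intro p _
          rw [gammaAbove_eq_zero (by simp only; omega), mul_zero]
      · have ht : (((t + 1 : ℕ) : ℤ) + 1 - 1) = t + 1 := by push_cast; ring
        -- The last summand is the trivial path at the top right corner of the cell `(x, t)`. It
        -- cancels the correction term of `card_valleySets_succ_succ`.
        have hrec : ∀ p ∈ N, ((valleySets N p.1 p.2).card : ℤ) *
            gammaAbove (p.1 + 1, p.2 + 2) ((x + 1 : ℕ), (t + 1 : ℕ) + 1) =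
            (valleySets N p.1 p.2).card * gammaAbove (p.1 + 1, p.2 + 2) (x, (t + 1 : ℕ) + 1) +
            (valleySets N p.1 p.2).card * gammaAbove (p.1 + 1, p.2 + 2) ((x + 1 : ℕ), t + 1) +
            if p = (x, t) then ((valleySets N x t).card : ℤ) else 0 := by
          intro p _
          rw [gammaAbove_rec (q := (((x + 1 : ℕ) : ℤ), ((t + 1 : ℕ) : ℤ) + 1))
            (by simp only; omega)]
          simp only [hx, ht]
          by_cases hp : p = (x, t)
          · subst hp
            rw [if_pos (by simp only [Prod.mk.injEq]; omega), if_pos rfl]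
            ring
          · rw [if_neg, if_neg hp]
            · ring
            · intro he
              simp only [Prod.mk.injEq] at he
              exact hp (Prod.ext (by omega) (by omega))
        rw [Finset.sum_congr rfl hrec, Finset.sum_add_distrib, Finset.sum_add_distrib,
          Finset.sum_ite_eq' N (x, t), ht]
        -- An endpoint on the diagonal is separate: its southern neighbour lies below the diagonal,
        -- so the induction hypothesis does not apply there.
        rcases h.eq_or_lt with h | h
        · obtain rfl : x = t + 1 := by omega
          have hnot : (t + 1, t) ∉ N := fun hh => by simpa using hN _ hh
          rw [if_neg hnot, gammaAbove_eq_zero_of_below (by simp only; omega),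
            Finset.sum_eq_zero (f := fun p : ℕ × ℕ => ((valleySets N p.1 p.2).card : ℤ) *
              gammaAbove (p.1 + 1, p.2 + 2) ((t + 1 + 1 : ℕ), t + 1)),
            valleySets_eq_of_forall (x := t + 1 + 1) (t := t + 1) (x' := t + 1) (t' := t + 1)
              (by intros; omega)]
          · ring
          · intro p _
            rw [gammaAbove_eq_zero_of_below (by simp only; omega), mul_zero]
        · rw [ih (x + 1) t (by omega) (by omega), card_valleySets_succ_succ N (by omega)]
          ring

/-! ### Evaluation of the determinant -/

/-- The set of cells attached to a list of pairs of indices. -/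
def cellSet {n k : ℕ} (i j : Fin k → Fin n) : Finset (ℕ × ℕ) :=
  Finset.univ.image fun l => ((i l : ℕ), (j l : ℕ))

/-- The block of path counts between the cells, with `1` on the diagonal, is unitriangular. -/
lemma det_gammaAbove_block {n k : ℕ} (i j : Fin k → Fin n) :
    (Matrix.of fun a b : Fin k =>
      if a = b then 1 else gammaAbove (vTR (i b) (j b)) (vBL (i a) (j a))).det = 1 := by
  set U := Matrix.of fun a b : Fin k =>
      if a = b then 1 else gammaAbove (vTR (i b) (j b)) (vBL (i a) (j a))
  -- A path from `v^tr_b` starts at abscissa `i b + 1` and cannot go west to abscissa `i a`. This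
  -- gives triangularity by `i` and also kills the off-diagonal entries inside a block of equal `i`.
  have hU : ∀ a b, a ≠ b → i a ≤ i b → U a b = 0 := by
    intro a b hab h
    have h' : (i a : ℕ) ≤ i b := h
    simp only [U, Matrix.of_apply, if_neg hab]
    exact gammaAbove_eq_zero (by simp only [vTR, vBL]; omega)
  have htri : U.BlockTriangular (fun a => OrderDual.toDual (i a)) := by
    intro a b hab
    have : i a < i b := hab
    exact hU a b (fun h => by simp [h] at this) this.le
  rw [htri.det]
  refine Finset.prod_eq_one fun c _ => ?_
  have : U.toSquareBlock (fun a => OrderDual.toDual (i a)) c = 1 := by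
    ext ⟨a, ha⟩ ⟨b, hb⟩
    rw [Matrix.toSquareBlock_def, Matrix.of_apply]
    by_cases hab : a = b
    · subst hab
      simp [U]
    · rw [hU a b hab (OrderDual.toDual.injective (ha.trans hb.symm)).le,
        Matrix.one_apply_ne (by simpa using hab)]
  rw [this, Matrix.det_one]

/-- Cramer's rule as a factorization: the last column is the combination of the other columns with
coefficients `V(p)`, plus `V(n, n)` times the last unit vector. -/
theorem det_cornerMatrix {n k : ℕ} (i j : Fin k → Fin n) (hij : ∀ l, i l ≤ j l)
    (hinj : Function.Injective fun l => (i l, j l)) :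
    (cornerMatrix n i j).det = ((valleySets (cellSet i j) n n).card : ℤ) := by
  set N := cellSet i j with hNdef
  have hN : ∀ p ∈ N, p.1 ≤ p.2 := by
    intro p hp
    obtain ⟨l, -, rfl⟩ := Finset.mem_image.1 hp
    exact hij l
  have hinj' : Function.Injective fun l => ((i l : ℕ), (j l : ℕ)) := by
    intro l m h
    simp only [Prod.mk.injEq] at h
    exact hinj (Prod.ext (Fin.ext h.1) (Fin.ext h.2))
  have hsum : ∀ x t : ℕ, x ≤ t + 1 → gammaAbove ptI (x, t + 1) = (valleySets N x t).card +
      ∑ l, gammaAbove (vTR (i l) (j l)) (x, t + 1) * (valleySets N (i l) (j l)).card := by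
    intro x t h
    rw [gammaAbove_ptI_eq_sum N hN x t h, hNdef, cellSet, Finset.sum_image hinj'.injOn]
    congr 1
    refine Finset.sum_congr rfl fun l _ => ?_
    rw [mul_comm, vTR, add_assoc ((j l : ℕ) : ℤ), one_add_one_eq_two]
  set U := Matrix.of fun a b : Fin k =>
      if a = b then 1 else gammaAbove (vTR (i b) (j b)) (vBL (i a) (j a)) with hU
  set r := Matrix.of fun (_ : Unit) (b : Fin k) => gammaAbove (vTR (i b) (j b)) (ptF n) with hr
  have hfac : cornerMatrix n i j = Matrix.fromBlocks U 0 r 1 *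
      Matrix.fromBlocks 1 (Matrix.of fun a _ => ((valleySets N (i a) (j a)).card : ℤ)) 0
        (Matrix.of fun _ _ => ((valleySets N n n).card : ℤ)) := by
    rw [Matrix.fromBlocks_multiply]
    simp only [Matrix.mul_one, Matrix.mul_zero, Matrix.zero_mul, Matrix.one_mul, add_zero]
    unfold cornerMatrix
    congr 1
    · ext a u
      have hbl : vBL (i a) (j a) = (((i a : ℕ) : ℤ), ((j a : ℕ) : ℤ) + 1) := by simp [vBL]
      rw [Matrix.of_apply, Matrix.mul_apply]
      simp only [Matrix.of_apply, hU, hbl]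
      rw [hsum _ _ ((show (i a : ℕ) ≤ j a from hij a).trans (Nat.le_succ _)),
        ← Finset.add_sum_erase _ _ (Finset.mem_univ a),
        ← Finset.add_sum_erase _ (fun b => (if a = b then _ else _) * _) (Finset.mem_univ a)]
      -- The cell's own term in the path sum is zero, so the diagonal entry `1` instead carries the
      -- leading summand `V(p)`.
      rw [gammaAbove_eq_zero (by simp only [vTR]; omega), zero_mul, zero_add, if_pos rfl, one_mul]
      congr 1
      refine Finset.sum_congr rfl fun b hb => ?_
      rw [if_neg (Finset.ne_of_mem_erase hb).symm]
    · ext u v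
      rw [Matrix.of_apply, Matrix.add_apply, Matrix.mul_apply]
      simp only [Matrix.of_apply, hr]
      rw [ptF, hsum _ _ (Nat.le_succ _), add_comm]
  rw [hfac, Matrix.det_mul, Matrix.det_fromBlocks_zero₁₂, Matrix.det_fromBlocks_zero₂₁,
    hU, det_gammaAbove_block]
  simp

/-! ### Upper sets of the root poset outside `N` and their antichains -/

/-- The cells `(i, j)`, `i ≤ j < n`, outside `N`. -/
def cellsOff (N : Finset (ℕ × ℕ)) (n : ℕ) : Finset (ℕ × ℕ) :=
  {p ∈ Finset.range n ×ˢ Finset.range n | p.1 ≤ p.2 ∧ p ∉ N}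

lemma mem_cellsOff {N : Finset (ℕ × ℕ)} {n : ℕ} {p : ℕ × ℕ} :
    p ∈ cellsOff N n ↔ (p.1 < n ∧ p.2 < n) ∧ p.1 ≤ p.2 ∧ p ∉ N := by
  simp [cellsOff]

/-- The upper sets of the poset of cells outside `N`, with the order of the root poset. -/
def cellFilters (N : Finset (ℕ × ℕ)) (n : ℕ) : Finset (Finset (ℕ × ℕ)) :=
  {A ∈ (cellsOff N n).powerset |
    ∀ p ∈ A, ∀ q ∈ cellsOff N n, q.1 ≤ p.1 → p.2 ≤ q.2 → q ∈ A}

lemma mem_cellFilters {N : Finset (ℕ × ℕ)} {n : ℕ} {A : Finset (ℕ × ℕ)} :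
    A ∈ cellFilters N n ↔ A ⊆ cellsOff N n ∧
      ∀ p ∈ A, ∀ q ∈ cellsOff N n, q.1 ≤ p.1 → p.2 ≤ q.2 → q ∈ A := by
  simp [cellFilters]

/-- The minimal elements of a set of cells. -/
def minCells (A : Finset (ℕ × ℕ)) : Finset (ℕ × ℕ) :=
  {p ∈ A | ∀ q ∈ A, p.1 ≤ q.1 → q.2 ≤ p.2 → q = p}

lemma mem_minCells {A : Finset (ℕ × ℕ)} {p : ℕ × ℕ} :
    p ∈ minCells A ↔ p ∈ A ∧ ∀ q ∈ A, p.1 ≤ q.1 → q.2 ≤ p.2 → q = p := by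
  simp [minCells]

lemma exists_mem_minCells_le {A : Finset (ℕ × ℕ)} {p : ℕ × ℕ} (hp : p ∈ A) :
    ∃ q ∈ minCells A, p.1 ≤ q.1 ∧ q.2 ≤ p.2 := by
  -- The height `j - i` is strictly monotone for the root order; it is taken in `ℤ` because `A` may
  -- contain cells below the diagonal.
  obtain ⟨q, hq, hmin⟩ := Finset.exists_min_image ({q ∈ A | p.1 ≤ q.1 ∧ q.2 ≤ p.2})
    (fun q => (q.2 : ℤ) - q.1) ⟨p, by simp [hp]⟩
  simp only [Finset.mem_filter] at hq hmin
  refine ⟨q, mem_minCells.2 ⟨hq.1, fun r hr h1 h2 => ?_⟩, hq.2⟩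
  have := hmin r ⟨hr, by omega, by omega⟩
  exact Prod.ext (by omega) (by omega)

/-- An upper set and the antichain of its minimal elements determine each other; two cells are
incomparable in the root order exactly when one is strictly larger in both coordinates. -/
lemma card_cellFilters (N : Finset (ℕ × ℕ)) (n : ℕ) :
    (cellFilters N n).card = (valleySets N n n).card := by
  refine Finset.card_nbij' minCells
    (fun S => {q ∈ cellsOff N n | ∃ p ∈ S, q.1 ≤ p.1 ∧ p.2 ≤ q.2}) ?_ ?_ ?_ ?_
  · intro A hA
    obtain ⟨hA, -⟩ := mem_cellFilters.1 hA
    refine mem_valleySets.2 ⟨fun p hp => mem_cellsOff.1 (hA (mem_minCells.1 hp).1), ?_⟩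
    intro p hp q hq hne
    rw [mem_minCells] at hp hq
    have h1 : ¬ (p.1 ≤ q.1 ∧ q.2 ≤ p.2) := fun h => hne (hp.2 q hq.1 h.1 h.2).symm
    have h2 : ¬ (q.1 ≤ p.1 ∧ p.2 ≤ q.2) := fun h => hne (hq.2 p hp.1 h.1 h.2)
    omega
  · intro S _
    refine mem_cellFilters.2 ⟨Finset.filter_subset _ _, fun p hp q hq h1 h2 => ?_⟩
    rw [Finset.mem_filter] at hp ⊢
    obtain ⟨-, r, hr, h3, h4⟩ := hp
    exact ⟨hq, r, hr, h1.trans h3, h4.trans h2⟩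
  · intro A hA
    obtain ⟨hA, hup⟩ := mem_cellFilters.1 hA
    ext q
    rw [Finset.mem_filter]
    constructor
    · rintro ⟨hq, p, hp, h1, h2⟩
      exact hup p (mem_minCells.1 hp).1 q hq h1 h2
    · exact fun hq => ⟨hA hq, exists_mem_minCells_le hq⟩
  · intro S hS
    obtain ⟨h1, h2⟩ := mem_valleySets.1 hS
    have hsub : ∀ p ∈ S, p ∈ ({q ∈ cellsOff N n | ∃ p ∈ S, q.1 ≤ p.1 ∧ p.2 ≤ q.2} :
        Finset (ℕ × ℕ)) := fun p hp =>
      Finset.mem_filter.2 ⟨mem_cellsOff.2 (h1 p hp), p, hp, le_rfl, le_rfl⟩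
    have hanti : ∀ p ∈ S, ∀ q ∈ S, p.1 ≤ q.1 → q.2 ≤ p.2 → q = p := by
      intro p hp q hq h3 h4
      by_contra hne
      have := h2 q hq p hp hne
      omega
    ext p
    rw [mem_minCells]
    constructor
    · rintro ⟨hp, hmin⟩
      obtain ⟨-, r, hr, h3, h4⟩ := Finset.mem_filter.1 hp
      exact hmin r (hsub r hr) h3 h4 ▸ hr
    · refine fun hp => ⟨hsub p hp, fun q hq h3 h4 => ?_⟩
      obtain ⟨-, r, hr, h5, h6⟩ := Finset.mem_filter.1 hq
      obtain rfl := hanti p hp r hr (h3.trans h5) (h6.trans h4)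
      exact Prod.ext (by omega) (by omega)

/-! ### Realizing upper sets by points of the dominant cone -/

/-- The cells outside `N` whose inequality `z i - z (j + 1) > 1` holds. -/
noncomputable def cellPattern (N : Finset (ℕ × ℕ)) (n : ℕ) (z : ℕ → ℝ) : Finset (ℕ × ℕ) :=
  {p ∈ cellsOff N n | 1 < z p.1 - z (p.2 + 1)}

lemma cellPattern_mem_cellFilters (N : Finset (ℕ × ℕ)) (n : ℕ) (z : ℕ → ℝ)
    (hz : ∀ a b, a < b → b ≤ n → z b < z a) : cellPattern N n z ∈ cellFilters N n := by
  refine mem_cellFilters.2 ⟨Finset.filter_subset _ _, fun p hp q hq h1 h2 => ?_⟩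
  obtain ⟨hp, hp'⟩ := Finset.mem_filter.1 hp
  refine Finset.mem_filter.2 ⟨hq, ?_⟩
  have hz' : ∀ a b, a ≤ b → b ≤ n → z b ≤ z a := fun a b h h' =>
    h.eq_or_lt.elim (fun h => h ▸ le_rfl) fun h => (hz a b h h').le
  have hp1 := mem_cellsOff.1 hp
  have hq1 := mem_cellsOff.1 hq
  have := hz' _ _ h1 (by omega)
  have := hz' (p.2 + 1) (q.2 + 1) (by omega) (by omega)
  linarith

/-- Decreasing sequences realize every monotone relation as the relation "the difference
exceeds `1`". -/
lemma exists_decreasing_realizing (R : ℕ → ℕ → Prop)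
    (hR : ∀ a b a' b', R a b → a' ≤ a → b ≤ b' → R a' b') (m : ℕ) :
    ∃ z : ℕ → ℝ, ∀ a b, a < b → b < m →
      z b < z a ∧ (R a b → 1 < z a - z b) ∧ (¬ R a b → z a - z b < 1) := by
  classical
  induction m with
  | zero => exact ⟨0, fun a b _ h => absurd h (Nat.not_lt_zero _)⟩
  | succ m ih =>
    obtain ⟨z, hz⟩ := ih
    have hmono : ∀ a b, a ≤ b → b < m → z b ≤ z a := fun a b h h' =>
      h.eq_or_lt.elim (fun h => h ▸ le_rfl) fun h => (hz a b h h').1.le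
    -- The new last value `c` must be below all earlier `z a`, below `z a - 1` when `R a m`, and
    -- above `z a - 1` otherwise. Monotonicity of `R` makes every lower bound smaller than every
    -- upper bound.
    obtain ⟨c, hc₁, hc₂⟩ := Finset.exists_between'
      (({a ∈ Finset.range m | ¬ R a m}).image fun a => z a - 1)
      ((Finset.range m).image z ∪ ({a ∈ Finset.range m | R a m}).image fun a => z a - 1) (by
        simp only [Finset.mem_image, Finset.mem_union, Finset.mem_filter, Finset.mem_range]
        rintro _ ⟨a, ⟨ha, haR⟩, rfl⟩ _ (⟨b, hb, rfl⟩ | ⟨b, ⟨hb, hbR⟩, rfl⟩)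
        · rcases le_or_gt b a with h | h
          · linarith [hmono b a h ha]
          · have := (hz a b h hb).2.2 fun hab => haR (hR _ _ _ _ hab le_rfl hb.le)
            linarith
        · rcases le_or_gt a b with h | h
          · exact absurd (hR _ _ _ _ hbR h le_rfl) haR
          · linarith [(hz b a h ha).1])
    simp only [Finset.mem_image, Finset.mem_union, Finset.mem_filter, Finset.mem_range] at hc₁ hc₂
    refine ⟨Function.update z m c, fun a b hab hb => ?_⟩
    rw [Function.update_of_ne (show a ≠ m by omega)]
    rcases (Nat.lt_succ_iff.1 hb).eq_or_lt with rfl | hb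
    · rw [Function.update_self]
      refine ⟨hc₂ _ (Or.inl ⟨a, hab, rfl⟩), fun h => ?_, fun h => ?_⟩
      · linarith [hc₂ _ (Or.inr ⟨a, ⟨hab, h⟩, rfl⟩)]
      · linarith [hc₁ _ ⟨a, ⟨hab, h⟩, rfl⟩]
    · rw [Function.update_of_ne (show b ≠ m by omega)]
      exact hz a b hab hb

lemma exists_cellPattern_eq (N : Finset (ℕ × ℕ)) (n : ℕ) {A : Finset (ℕ × ℕ)}
    (hA : A ∈ cellFilters N n) :
    ∃ z : ℕ → ℝ, (∀ a b, a < b → b ≤ n → z b < z a) ∧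
      (∀ a b, a < b → b ≤ n → z a - z b ≠ 1) ∧ cellPattern N n z = A := by
  obtain ⟨hsub, hup⟩ := mem_cellFilters.1 hA
  -- The relation is the upward closure of `A` among all cells, those of `N` included; the pair `(a,
  -- b)` stands for the cell `(a, b - 1)`. Since `A` is an upper set outside `N`, the closure adds
  -- only cells of `N`.
  obtain ⟨z, hz⟩ := exists_decreasing_realizing (fun a b => ∃ p ∈ A, a ≤ p.1 ∧ p.2 < b)
    (fun a b a' b' ⟨p, hp, h1, h2⟩ ha hb => ⟨p, hp, ha.trans h1, h2.trans_le hb⟩) (n + 1)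
  refine ⟨z, fun a b hab hb => (hz a b hab (by omega)).1, fun a b hab hb => ?_, ?_⟩
  · obtain ⟨-, h1, h2⟩ := hz a b hab (by omega)
    by_cases h : ∃ p ∈ A, a ≤ p.1 ∧ p.2 < b
    · exact (h1 h).ne'
    · exact (h2 h).ne
  · ext q
    rw [cellPattern, Finset.mem_filter]
    constructor
    · rintro ⟨hq, hlt⟩
      have hq' := mem_cellsOff.1 hq
      by_contra hqA
      refine (((hz q.1 (q.2 + 1) (by omega) (by omega)).2.2 ?_).trans hlt).false
      rintro ⟨p, hp, h1, h2⟩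
      exact hqA (hup p hp q hq h1 (by omega))
    · intro hq
      have hq' := mem_cellsOff.1 (hsub hq)
      exact ⟨hsub hq, (hz q.1 (q.2 + 1) (by omega) (by omega)).2.1 ⟨q, hq, le_rfl, by omega⟩⟩

/-- Two maps with the same fibres on `Y` have images in bijection. It is used to compare regions
with patterns. -/
lemma finite_image_and_ncard_image_eq {α β γ : Type*} [Nonempty α] {f : α → β} {g : α → γ}
    {Y : Set α} (h : ∀ y ∈ Y, ∀ y' ∈ Y, f y = f y' ↔ g y = g y') (hfin : (g '' Y).Finite) :
    (f '' Y).Finite ∧ (f '' Y).ncard = (g '' Y).ncard := by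
  set φ : γ → β := fun c => f (Function.invFunOn g Y c) with hφ
  have hφg : ∀ y ∈ Y, φ (g y) = f y := fun y hy => by
    have hex : ∃ a ∈ Y, g a = g y := ⟨y, hy, rfl⟩
    exact (h _ (Function.invFunOn_mem hex) y hy).2 (Function.invFunOn_eq hex)
  have himg : f '' Y = φ '' (g '' Y) := by
    rw [Set.image_image]
    exact Set.image_congr fun y hy => (hφg y hy).symm
  rw [himg]
  refine ⟨hfin.image φ, Set.InjOn.ncard_image ?_⟩
  rintro _ ⟨y, hy, rfl⟩ _ ⟨y', hy', rfl⟩ he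
  rw [hφg y hy, hφg y' hy'] at he
  exact (h y hy y' hy').1 he

/-! ### Regions in a Weyl cone as sign patterns -/

section Regions

variable {E : Type*} [NormedAddCommGroup E] [InnerProductSpace ℝ E]

lemma mem_compl_shiArrangement {P : Set E} {x : E} :
    x ∈ (⋃₀ shiArrangement P)ᶜ ↔ ∀ α ∈ P, inner ℝ α x ≠ 0 ∧ inner ℝ α x ≠ 1 := by
  simp only [shiArrangement, hyperplane, Set.mem_compl_iff, Set.mem_sUnion, Set.mem_ofPred_eq]
  constructor
  · exact fun h α hα => ⟨fun h0 => h ⟨_, ⟨α, hα, Or.inl rfl⟩, h0⟩,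
      fun h1 => h ⟨_, ⟨α, hα, Or.inr rfl⟩, h1⟩⟩
  · rintro h ⟨_, ⟨α, hα, rfl | rfl⟩, hx⟩
    · exact (h α hα).1 hx
    · exact (h α hα).2 hx

lemma lt_iff_lt_of_isPreconnected {X : Type*} [TopologicalSpace X] {S : Set X}
    (hS : IsPreconnected S) {f : X → ℝ} (hf : Continuous f) {k : ℝ} (hk : ∀ z ∈ S, f z ≠ k)
    {x y : X} (hx : x ∈ S) (hy : y ∈ S) : k < f x ↔ k < f y := by
  have hord := (hS.image f hf.continuousOn).ordConnected
  have key : ∀ {x y}, x ∈ S → y ∈ S → k < f x → k < f y := by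
    intro x y hx hy h
    by_contra hc
    obtain ⟨z, hz, hzk⟩ := hord.out (Set.mem_image_of_mem f hy) (Set.mem_image_of_mem f hx)
      ⟨not_lt.1 hc, h.le⟩
    exact hk z hz hzk
  exact ⟨key hx hy, key hy hx⟩

/-- Two points off the Shi arrangement are in the same region iff they are on the same side of
every hyperplane. -/
lemma connectedComponentIn_shiArrangement_eq_iff {P : Set E} {x y : E}
    (hx : x ∈ (⋃₀ shiArrangement P)ᶜ) (hy : y ∈ (⋃₀ shiArrangement P)ᶜ) :
    connectedComponentIn (⋃₀ shiArrangement P)ᶜ x = connectedComponentIn (⋃₀ shiArrangement P)ᶜ y ↔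
      ∀ α ∈ P, ((0 : ℝ) < inner ℝ α x ↔ (0 : ℝ) < inner ℝ α y) ∧
        ((1 : ℝ) < inner ℝ α x ↔ (1 : ℝ) < inner ℝ α y) := by
  constructor
  · intro h α hα
    have hx' := mem_connectedComponentIn hx
    have hy' := mem_connectedComponentIn hy
    rw [← h] at hy'
    have hcont : Continuous fun z : E => (inner ℝ α z : ℝ) := by fun_prop
    have hne := fun z (hz : z ∈ connectedComponentIn (⋃₀ shiArrangement P)ᶜ x) =>
      mem_compl_shiArrangement.1 (connectedComponentIn_subset (⋃₀ shiArrangement P)ᶜ x hz) α hα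
    exact ⟨lt_iff_lt_of_isPreconnected isPreconnected_connectedComponentIn hcont
        (fun z hz => (hne z hz).1) hx' hy',
      lt_iff_lt_of_isPreconnected isPreconnected_connectedComponentIn hcont
        (fun z hz => (hne z hz).2) hx' hy'⟩
  · intro h
    apply connectedComponentIn_eq
    -- Points on the same strict side of every hyperplane are joined by a segment that avoids the
    -- arrangement.
    refine (convex_segment x y).isPreconnected.subset_connectedComponentIn
      (left_mem_segment ℝ x y) ?_ (right_mem_segment ℝ x y)
    rintro _ ⟨a, b, ha, hb, hab, rfl⟩
    rw [mem_compl_shiArrangement] at hx hy ⊢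
    intro α hα
    have key : ∀ k s t : ℝ, s ≠ k → t ≠ k → (k < s ↔ k < t) → a * s + b * t ≠ k := by
      intro k s t hs ht hst he
      obtain rfl : a = 1 - b := by linarith
      have hk : (1 - b) * (s - k) + b * (t - k) = 0 := by linarith
      rcases lt_or_gt_of_ne hs with h1 | h1
      · have h2 : t < k := lt_of_le_of_ne (not_lt.1 fun h => h1.not_gt (hst.2 h)) ht
        rcases hb.eq_or_lt with rfl | hb
        · linarith
        · nlinarith [mul_pos hb (sub_pos.2 h2), mul_nonneg ha (sub_pos.2 h1).le]
      · have h2 := hst.1 h1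
        rcases hb.eq_or_lt with rfl | hb
        · linarith
        · nlinarith [mul_pos hb (sub_pos.2 h2), mul_nonneg ha (sub_pos.2 h1).le]
    rw [inner_add_right, inner_smul_right, inner_smul_right]
    exact ⟨key 0 _ _ (hx α hα).1 (hy α hα).1 (h α hα).1,
      key 1 _ _ (hx α hα).2 (hy α hα).2 (h α hα).2⟩

lemma inner_map_right (w : E ≃ₗᵢ[ℝ] E) (α y : E) : inner ℝ α (w y) = inner ℝ (w.symm α) y := by
  rw [← w.inner_map_map (w.symm α) y, w.apply_symm_apply]

/-- The points of the dominant cone whose images under `w` are off the Shi arrangement. -/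
def genericDominant (P : Set E) (w : E ≃ₗᵢ[ℝ] E) : Set E :=
  {y ∈ dominantCone P | ∀ β ∈ P, β ∉ inversionSet P w⁻¹ → inner ℝ β y ≠ 1}

variable {P : Set E} {w : E ≃ₗᵢ[ℝ] E}

lemma map_mem_of_notMem_inversionSet (hw : ∀ α ∈ roots P, w α ∈ roots P) {β : E} (hβ : β ∈ P)
    (hinv : β ∉ inversionSet P w⁻¹) : w β ∈ P := by
  rcases hw β (Or.inl hβ) with h | h
  · exact h
  · exact absurd ⟨hβ, w β, h, w.symm_apply_apply β⟩ hinv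

/-- If `w⁻¹ α` is a negative root, it is negative on the whole dominant cone, so neither `H_{α,0}`
nor `H_{α,1}` meets `C_w`. Otherwise it is a positive root not inverted by `w`. -/
lemma symm_mem_or_inner_neg (hw : ∀ α ∈ roots P, w.symm α ∈ roots P) {y : E}
    (hy : y ∈ dominantCone P) {α : E} (hα : α ∈ P) :
    (w.symm α ∈ P ∧ w.symm α ∉ inversionSet P w⁻¹) ∨ inner ℝ (w.symm α) y < 0 := by
  rcases hw α (Or.inl hα) with h | h
  · refine Or.inl ⟨h, ?_⟩
    rintro ⟨-, γ, hγ, he⟩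
    obtain rfl : γ = α := w.symm.injective he
    have h1 := hy _ hα
    have h2 := hy _ hγ
    rw [inner_neg_left] at h2
    linarith
  · have := hy _ h
    rw [inner_neg_left] at this
    exact Or.inr (by linarith)

lemma map_mem_compl_shiArrangement (hw : ∀ α ∈ roots P, w.symm α ∈ roots P) {y : E}
    (hy : y ∈ genericDominant P w) : w y ∈ (⋃₀ shiArrangement P)ᶜ := by
  rw [mem_compl_shiArrangement]
  intro α hα
  rw [inner_map_right]
  rcases symm_mem_or_inner_neg hw hy.1 hα with ⟨h1, h2⟩ | h
  · exact ⟨(hy.1 _ h1).ne', hy.2 _ h1 h2⟩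
  · exact ⟨h.ne, (h.trans one_pos).ne⟩

/-- The walls of `C_w` belong to the arrangement, so a region with one point in `C_w` lies entirely
inside it. -/
lemma regionsInCone_eq_image (hw : ∀ α ∈ roots P, w α ∈ roots P)
    (hw' : ∀ α ∈ roots P, w.symm α ∈ roots P) :
    regionsInCone P w =
      (fun y => connectedComponentIn (⋃₀ shiArrangement P)ᶜ (w y)) '' genericDominant P w := by
  ext R
  constructor
  · rintro ⟨⟨x, hx, rfl⟩, hR⟩
    obtain ⟨y, hy, rfl⟩ := hR (mem_connectedComponentIn hx)
    refine ⟨y, ⟨hy, fun β hβ hinv => ?_⟩, rfl⟩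
    have := (mem_compl_shiArrangement.1 hx _ (map_mem_of_notMem_inversionSet hw hβ hinv)).2
    rwa [w.inner_map_map] at this
  · rintro ⟨y, hy, rfl⟩
    have hc := map_mem_compl_shiArrangement hw' hy
    refine ⟨⟨_, hc, rfl⟩, fun z hz => ⟨w.symm z, fun β hβ => ?_, w.apply_symm_apply z⟩⟩
    have hzc := connectedComponentIn_subset _ _ hz
    have hside := (connectedComponentIn_shiArrangement_eq_iff hc hzc).1
      (connectedComponentIn_eq hz)
    rw [inner_map_right, LinearIsometryEquiv.symm_symm]
    rcases hw β (Or.inl hβ) with h | h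
    · rw [← (hside _ h).1, w.inner_map_map]
      exact hy.1 β hβ
    -- Here `-w β` is the positive root, so the side is read off from its hyperplane with the sign
    -- reversed.
    · have h1 := (hside _ h).1.not
      have h2 := (mem_compl_shiArrangement.1 hzc _ h).1
      have h3 := hy.1 β hβ
      simp only [inner_neg_left, w.inner_map_map] at h1 h2
      have h4 := h1.1 (by linarith)
      exact lt_of_le_of_ne (by linarith) (fun h => h2 (by rw [← h, neg_zero]))

lemma connectedComponentIn_map_eq_iff (hw : ∀ α ∈ roots P, w α ∈ roots P)
    (hw' : ∀ α ∈ roots P, w.symm α ∈ roots P) {y y' : E} (hy : y ∈ genericDominant P w)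
    (hy' : y' ∈ genericDominant P w) :
    connectedComponentIn (⋃₀ shiArrangement P)ᶜ (w y) =
        connectedComponentIn (⋃₀ shiArrangement P)ᶜ (w y') ↔
      ∀ β ∈ P, β ∉ inversionSet P w⁻¹ → ((1 : ℝ) < inner ℝ β y ↔ (1 : ℝ) < inner ℝ β y') := by
  rw [connectedComponentIn_shiArrangement_eq_iff (map_mem_compl_shiArrangement hw' hy)
    (map_mem_compl_shiArrangement hw' hy')]
  constructor
  · intro h β hβ hinv
    have := (h _ (map_mem_of_notMem_inversionSet hw hβ hinv)).2
    rwa [w.inner_map_map, w.inner_map_map] at this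
  · intro h α hα
    rw [inner_map_right, inner_map_right]
    rcases symm_mem_or_inner_neg hw' hy.1 hα with ⟨h1, h2⟩ | h1
    · exact ⟨iff_of_true (hy.1 _ h1) (hy'.1 _ h1), h _ h1 h2⟩
    · rcases symm_mem_or_inner_neg hw' hy'.1 hα with ⟨h2, -⟩ | h2
      · exact absurd (hy.1 _ h2) h1.not_gt
      · exact ⟨iff_of_false h1.not_gt h2.not_gt,
          iff_of_false (h1.trans one_pos).not_gt (h2.trans one_pos).not_gt⟩

end Regions

/-! ### Roots and reflections of type A in coordinates -/

section TypeA

variable {n : ℕ}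

lemma mem_roots_posRootsA {α : EuclideanSpace ℝ (Fin (n + 1))} :
    α ∈ roots (posRootsA n) ↔ ∃ a b : Fin (n + 1), a ≠ b ∧
      α = EuclideanSpace.single a (1 : ℝ) - EuclideanSpace.single b (1 : ℝ) := by
  constructor
  · rintro (⟨a, b, hab, rfl⟩ | ⟨a, b, hab, h⟩)
    · exact ⟨a, b, hab.ne, rfl⟩
    · exact ⟨b, a, hab.ne', by rw [← neg_neg α, h, neg_sub]⟩
  · rintro ⟨a, b, hab, rfl⟩
    rcases lt_or_gt_of_ne hab with h | h
    · exact Or.inl ⟨a, b, h, rfl⟩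
    · exact Or.inr ⟨b, a, h, neg_sub _ _⟩

/-- Reflections act on the standard basis as transpositions, which is why the Weyl group preserves
the set of roots. -/
lemma rootReflection_single {a b : Fin (n + 1)} (hab : a ≠ b) (c : Fin (n + 1)) :
    rootReflection (EuclideanSpace.single a (1 : ℝ) - EuclideanSpace.single b (1 : ℝ))
      (EuclideanSpace.single c (1 : ℝ)) = EuclideanSpace.single (Equiv.swap a b c) (1 : ℝ) := by
  set α := EuclideanSpace.single a (1 : ℝ) - EuclideanSpace.single b (1 : ℝ) with hα
  have hinner : ∀ c, inner ℝ α (EuclideanSpace.single c (1 : ℝ)) =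
      (if a = c then 1 else 0) - (if b = c then 1 else 0) := fun c => by
    simp [hα, inner_sub_left, EuclideanSpace.inner_single_left]
  have hnorm : ‖α‖ ^ 2 = 2 := by
    rw [← real_inner_self_eq_norm_sq]
    nth_rw 2 [hα]
    rw [inner_sub_right, hinner, hinner]
    simp only [hab, hab.symm, if_true, if_false]
    norm_num
  have hval : rootReflection α (EuclideanSpace.single c (1 : ℝ)) =
      EuclideanSpace.single c (1 : ℝ) -
        ((if a = c then 1 else 0) - (if b = c then 1 else 0) : ℝ) • α := by
    rw [rootReflection, Submodule.reflection_orthogonal_apply, Submodule.reflection_singleton_apply,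
      hinner]
    simp only [RCLike.ofReal_real_eq_id, id, hnorm]
    rw [two_smul, ← add_smul, neg_sub, add_halves]
  rw [hval, hα]
  by_cases hac : a = c
  · subst hac
    simp [hab.symm]
  by_cases hbc : b = c
  · subst hbc
    simp [hac]
  · rw [Equiv.swap_apply_of_ne_of_ne (Ne.symm hac) (Ne.symm hbc)]
    simp [hac, hbc]

lemma map_mem_roots_of_mem_weylGroup
    {w : EuclideanSpace ℝ (Fin (n + 1)) ≃ₗᵢ[ℝ] EuclideanSpace ℝ (Fin (n + 1))}
    (hw : w ∈ weylGroup (posRootsA n)) :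
    (∀ α ∈ roots (posRootsA n), w α ∈ roots (posRootsA n)) ∧
      ∀ α ∈ roots (posRootsA n), w.symm α ∈ roots (posRootsA n) := by
  induction hw using Subgroup.closure_induction with
  | mem s hs =>
    obtain ⟨γ, hγ, rfl⟩ := hs
    obtain ⟨a, b, hab, rfl⟩ := mem_roots_posRootsA.1 hγ
    have key : ∀ α ∈ roots (posRootsA n), rootReflection
        (EuclideanSpace.single a (1 : ℝ) - EuclideanSpace.single b (1 : ℝ)) α ∈
          roots (posRootsA n) := by
      intro α hα
      obtain ⟨c, d, hcd, rfl⟩ := mem_roots_posRootsA.1 hα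
      rw [map_sub, rootReflection_single hab, rootReflection_single hab]
      exact mem_roots_posRootsA.2 ⟨_, _, (Equiv.swap a b).injective.ne hcd, rfl⟩
    exact ⟨key, by rwa [rootReflection, Submodule.reflection_symm]⟩
  | one => exact ⟨fun α h => h, fun α h => h⟩
  | mul x y _ _ hx hy =>
    exact ⟨fun α h => hx.1 _ (hy.1 α h), fun α h => hy.2 _ (hx.2 α h)⟩
  | inv x _ hx => exact ⟨hx.2, hx.1⟩

lemma rootA_eq {i j : Fin n} (hij : i ≤ j) :
    rootA n i j = EuclideanSpace.single i.castSucc (1 : ℝ) -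
      EuclideanSpace.single j.succ (1 : ℝ) := by
  set g : ℕ → EuclideanSpace ℝ (Fin (n + 1)) :=
    fun m => EuclideanSpace.single (Fin.ofNat (n + 1) m) (1 : ℝ) with hg
  have hcast : ∀ k : Fin n, k.castSucc = Fin.ofNat (n + 1) k := fun k => by
    ext; simp
  have hsucc : ∀ k : Fin n, k.succ = Fin.ofNat (n + 1) (k + 1) := fun k => by
    ext; simp [Nat.mod_eq_of_lt (Nat.succ_lt_succ k.isLt)]
  have htel : ∀ a b : ℕ, a ≤ b → ∑ m ∈ Finset.Icc a b, (g m - g (m + 1)) = g a - g (b + 1) := by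
    intro a b hab
    induction b, hab using Nat.le_induction with
    | base => simp
    | succ b hb ih =>
      rw [← Finset.insert_Icc_right_eq_Icc_add_one (by omega), Finset.sum_insert (by simp), ih]
      abel
  rw [hcast, hsucc, ← htel i j hij, ← Fin.map_valEmbedding_Icc, Finset.sum_map, rootA]
  refine Finset.sum_congr rfl fun k _ => ?_
  rw [simpleRootA, hcast, hsucc]
  rfl

lemma mem_posRootsA_iff {β : EuclideanSpace ℝ (Fin (n + 1))} :
    β ∈ posRootsA n ↔ ∃ i j : Fin n, i ≤ j ∧ β = rootA n i j := by
  constructor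
  · rintro ⟨a, b, hab, rfl⟩
    have hab' : (a : ℕ) < b := hab
    refine ⟨⟨a, by omega⟩, ⟨b - 1, by omega⟩, Fin.mk_le_mk.2 (by omega), ?_⟩
    rw [rootA_eq (Fin.mk_le_mk.2 (by omega))]
    congr 2
    ext
    simp only [Fin.succ_mk]
    omega
  · rintro ⟨i, j, hij, rfl⟩
    exact ⟨i.castSucc, j.succ, Fin.castSucc_lt_succ_iff.2 hij, rootA_eq hij⟩

lemma rootA_injective {i j i' j' : Fin n} (hij : i ≤ j) (hij' : i' ≤ j')
    (h : rootA n i j = rootA n i' j') : i = i' ∧ j = j' := by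
  rw [rootA_eq hij, rootA_eq hij'] at h
  have hne : i.castSucc ≠ j.succ := (Fin.castSucc_lt_succ_iff.2 hij).ne
  have h1 := congrArg (fun v : EuclideanSpace ℝ (Fin (n + 1)) => v i.castSucc) h
  have h2 := congrArg (fun v : EuclideanSpace ℝ (Fin (n + 1)) => v j.succ) h
  simp only [PiLp.sub_apply, PiLp.single_apply, hne, hne.symm, if_true, if_false] at h1 h2
  constructor
  · by_contra hc
    rw [if_neg fun h => hc (Fin.castSucc_injective n h)] at h1
    split_ifs at h1 <;> norm_num at h1
  · by_contra hc
    rw [if_neg fun h => hc (Fin.succ_injective n h)] at h2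
    split_ifs at h2 <;> norm_num at h2

lemma inner_rootA {i j : Fin n} (hij : i ≤ j) (y : EuclideanSpace ℝ (Fin (n + 1))) :
    inner ℝ (rootA n i j) y = y i.castSucc - y j.succ := by
  rw [rootA_eq hij, inner_sub_left, EuclideanSpace.inner_single_left,
    EuclideanSpace.inner_single_left]
  simp

end TypeA

/-! ### Counting the regions of type A by valley sets -/

section Counting

variable {n k : ℕ} {i j : Fin k → Fin n}
  {w : EuclideanSpace ℝ (Fin (n + 1)) ≃ₗᵢ[ℝ] EuclideanSpace ℝ (Fin (n + 1))}

/-- The coordinates of a vector as a sequence indexed by `ℕ`. -/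
def coordSeq (y : EuclideanSpace ℝ (Fin (n + 1))) (m : ℕ) : ℝ := y (Fin.ofNat (n + 1) m)

lemma coordSeq_of_lt (y : EuclideanSpace ℝ (Fin (n + 1))) (m : Fin (n + 1)) :
    coordSeq y m = y m := by
  simp [coordSeq]

lemma inner_rootA_eq_coordSeq {a b : Fin n} (hab : a ≤ b)
    (y : EuclideanSpace ℝ (Fin (n + 1))) :
    inner ℝ (rootA n a b) y = coordSeq y a - coordSeq y (b + 1) := by
  rw [inner_rootA hab, ← coordSeq_of_lt, ← coordSeq_of_lt, Fin.val_castSucc, Fin.val_succ]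

/-- The dominant cone consists of the vectors with decreasing coordinates. -/
lemma mem_dominantCone_iff {y : EuclideanSpace ℝ (Fin (n + 1))} :
    y ∈ dominantCone (posRootsA n) ↔ ∀ a b, a < b → b ≤ n → coordSeq y b < coordSeq y a := by
  constructor
  · intro hy a b hab hb
    have h := hy _ (mem_posRootsA_iff.2 ⟨⟨a, by omega⟩, ⟨b - 1, by omega⟩,
      Fin.mk_le_mk.2 (by omega), rfl⟩)
    rw [inner_rootA_eq_coordSeq (Fin.mk_le_mk.2 (by omega))] at h
    simp only [show b - 1 + 1 = b by omega] at h
    linarith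
  · intro h β hβ
    obtain ⟨a, b, hab, rfl⟩ := mem_posRootsA_iff.1 hβ
    rw [inner_rootA_eq_coordSeq hab]
    have hab' : (a : ℕ) ≤ b := hab
    linarith [h a (b + 1) (by omega) (by omega)]

lemma mem_cellsOff_iff (hij : ∀ l, i l ≤ j l)
    (hinv : inversionSet (posRootsA n) w⁻¹ = Set.range fun l => rootA n (i l) (j l))
    (a b : Fin n) :
    ((a : ℕ), (b : ℕ)) ∈ cellsOff (cellSet i j) n ↔
      a ≤ b ∧ rootA n a b ∉ inversionSet (posRootsA n) w⁻¹ := by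
  rw [mem_cellsOff, hinv]
  simp only [a.isLt, b.isLt, and_self, true_and, Fin.val_fin_le]
  refine and_congr_right fun hab => not_congr ?_
  simp only [cellSet, Finset.mem_image, Finset.mem_univ, true_and, Set.mem_range, Prod.mk.injEq]
  refine exists_congr fun l => ⟨fun h => ?_, fun h => ?_⟩
  · rw [Fin.ext h.1, Fin.ext h.2]
  · obtain ⟨h1, h2⟩ := rootA_injective (hij l) hab h
    rw [h1, h2]
    exact ⟨rfl, rfl⟩

lemma forall_notMem_inversionSet_iff (hij : ∀ l, i l ≤ j l)
    (hinv : inversionSet (posRootsA n) w⁻¹ = Set.range fun l => rootA n (i l) (j l))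
    (p : EuclideanSpace ℝ (Fin (n + 1)) → Prop) :
    (∀ β ∈ posRootsA n, β ∉ inversionSet (posRootsA n) w⁻¹ → p β) ↔
      ∀ a b : Fin n, ((a : ℕ), (b : ℕ)) ∈ cellsOff (cellSet i j) n → p (rootA n a b) := by
  constructor
  · intro h a b hab
    rw [mem_cellsOff_iff hij hinv] at hab
    exact h _ (mem_posRootsA_iff.2 ⟨a, b, hab.1, rfl⟩) hab.2
  · intro h β hβ hβ'
    obtain ⟨a, b, hab, rfl⟩ := mem_posRootsA_iff.1 hβ
    exact h a b ((mem_cellsOff_iff hij hinv a b).2 ⟨hab, hβ'⟩)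

lemma cellPattern_eq_iff (hij : ∀ l, i l ≤ j l)
    (hinv : inversionSet (posRootsA n) w⁻¹ = Set.range fun l => rootA n (i l) (j l))
    (y y' : EuclideanSpace ℝ (Fin (n + 1))) :
    cellPattern (cellSet i j) n (coordSeq y) = cellPattern (cellSet i j) n (coordSeq y') ↔
      ∀ β ∈ posRootsA n, β ∉ inversionSet (posRootsA n) w⁻¹ →
        ((1 : ℝ) < inner ℝ β y ↔ (1 : ℝ) < inner ℝ β y') := by
  rw [forall_notMem_inversionSet_iff hij hinv, cellPattern, cellPattern, Finset.filter_inj']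
  constructor
  · intro h a b hab
    have hab' := ((mem_cellsOff_iff hij hinv a b).1 hab).1
    rw [inner_rootA_eq_coordSeq hab', inner_rootA_eq_coordSeq hab']
    exact h hab
  · rintro h ⟨a, b⟩ hab
    have hlt := (mem_cellsOff.1 hab).1
    have hab' := ((mem_cellsOff_iff hij hinv ⟨a, hlt.1⟩ ⟨b, hlt.2⟩).1 hab).1
    have := h ⟨a, hlt.1⟩ ⟨b, hlt.2⟩ hab
    rwa [inner_rootA_eq_coordSeq hab', inner_rootA_eq_coordSeq hab'] at this

lemma image_cellPattern_genericDominant (hij : ∀ l, i l ≤ j l)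
    (hinv : inversionSet (posRootsA n) w⁻¹ = Set.range fun l => rootA n (i l) (j l)) :
    (fun y => cellPattern (cellSet i j) n (coordSeq y)) '' genericDominant (posRootsA n) w =
      cellFilters (cellSet i j) n := by
  ext A
  constructor
  · rintro ⟨y, hy, rfl⟩
    exact cellPattern_mem_cellFilters _ _ _ (mem_dominantCone_iff.1 hy.1)
  · intro hA
    obtain ⟨z, hz, hz1, rfl⟩ := exists_cellPattern_eq _ _ hA
    set y : EuclideanSpace ℝ (Fin (n + 1)) := WithLp.toLp 2 fun m => z m with hy
    have hcoord : ∀ m ≤ n, coordSeq y m = z m := fun m hm => by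
      simp [coordSeq, hy, Nat.mod_eq_of_lt (Nat.lt_succ_of_le hm)]
    refine ⟨y, ⟨mem_dominantCone_iff.2 fun a b hab hb => ?_,
      (forall_notMem_inversionSet_iff hij hinv _).2 fun a b hab => ?_⟩, ?_⟩
    · rw [hcoord a (by omega), hcoord b hb]
      exact hz a b hab hb
    · have hab' := ((mem_cellsOff_iff hij hinv a b).1 hab).1
      have hle : (a : ℕ) ≤ b := hab'
      rw [inner_rootA_eq_coordSeq hab', hcoord _ (by omega), hcoord _ (by omega)]
      exact hz1 _ _ (by omega) (by omega)
    · refine Finset.filter_congr fun p hp => ?_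
      have := mem_cellsOff.1 hp
      rw [hcoord _ (by omega), hcoord _ (by omega)]

/-- On generic dominant points, the region of `w y` and the cell pattern of `y` have the same
fibres, and the patterns that occur are all the upper sets. -/
theorem finite_and_ncard_regionsInCone (hw : w ∈ weylGroup (posRootsA n))
    (hij : ∀ l, i l ≤ j l)
    (hinv : inversionSet (posRootsA n) w⁻¹ = Set.range fun l => rootA n (i l) (j l)) :
    (regionsInCone (posRootsA n) w).Finite ∧
      (regionsInCone (posRootsA n) w).ncard = (valleySets (cellSet i j) n n).card := by
  obtain ⟨h1, h2⟩ := map_mem_roots_of_mem_weylGroup hw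
  have himg := image_cellPattern_genericDominant hij hinv
  have := finite_image_and_ncard_image_eq (Y := genericDominant (posRootsA n) w)
    (f := fun y => connectedComponentIn (⋃₀ shiArrangement (posRootsA n))ᶜ (w y))
    (g := fun y => cellPattern (cellSet i j) n (coordSeq y))
    (fun y hy y' hy' => (connectedComponentIn_map_eq_iff h1 h2 hy hy').trans
      (cellPattern_eq_iff hij hinv y y').symm) (himg ▸ Finset.finite_toSet _)
  rwa [← regionsInCone_eq_image h1 h2, himg, Set.ncard_coe_finset, card_cellFilters] at this

end Counting

end ShiTypeA

theorem mainTheorem2 :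
    (∀ (n : ℕ) (w : EuclideanSpace ℝ (Fin (n + 1)) ≃ₗᵢ[ℝ] EuclideanSpace ℝ (Fin (n + 1))),
      w ∈ ShiTypeA.weylGroup (ShiTypeA.posRootsA n) →
      ∀ (k : ℕ) (i j : Fin k → Fin n),
        (∀ l, i l ≤ j l) →
        Function.Injective (fun l => ShiTypeA.rootA n (i l) (j l)) →
        ShiTypeA.inversionSet (ShiTypeA.posRootsA n) w⁻¹ =
          Set.range (fun l => ShiTypeA.rootA n (i l) (j l)) →
        (ShiTypeA.regionsInCone (ShiTypeA.posRootsA n) w).Finite ∧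
        ((ShiTypeA.regionsInCone (ShiTypeA.posRootsA n) w).ncard : ℤ) =
          (ShiTypeA.cornerMatrix n i j).det) ∧
    (∀ x₁ y₁ x₂ y₂ : ℤ, x₁ ≤ y₁ → x₂ ≤ y₂ →
      (ShiTypeA.pathsAbove (x₁, y₁) (x₂, y₂)).Finite ∧
      ShiTypeA.gammaAbove (x₁, y₁) (x₂, y₂) =
        if x₁ ≤ x₂ ∧ y₁ ≤ y₂ then
          ((x₂ + y₂ - x₁ - y₁).toNat.choose (x₂ - x₁).toNat : ℤ) -
            ((x₂ + y₂ - x₁ - y₁).toNat.choose (y₂ - x₁ + 1).toNat : ℤ)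
        else 0) := by
  refine ⟨fun n w hw k i j hij hinj hinv => ?_, fun x₁ y₁ x₂ y₂ h₁ h₂ =>
    ⟨ShiTypeA.pathsAbove_finite _ _, ShiTypeA.gammaAbove_eq x₁ y₁ x₂ y₂ h₁ h₂⟩⟩
  obtain ⟨hfin, hcard⟩ := ShiTypeA.finite_and_ncard_regionsInCone hw hij hinv
  refine ⟨hfin, ?_⟩
  rw [hcard, ShiTypeA.det_cornerMatrix i j hij]
  intro l m h
  simp only [Prod.mk.injEq] at h
  exact hinj (by simp only [h.1, h.2])
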